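/- Let $n\ge 2$, $2\le p\le\infty$, $N\ge 0$, and let $u_1,\dots,u_N:\mathbb{R}^n\to(-\infty,\infty]$ be radial $p$-superharmonic functions on $\mathbb{R}^n$. Then for all points $y_1,\dots,y_N\in\mathbb{R}^n$ and every concave function $K:\mathbb{R}^n\to\mathbb{R}$, the sum $$x\mapsto \sum_{i=1}^N u_i(x-y_i)+K(x)$$ is $p$-superharmonic on $\mathbb{R}^n$. Here $u$ is radial if $u(x)=U(|x|)$ for some one-variable function $U$, with $|\cdot|$ the Euclidean norm. A function $u:\mathbb{R}^n\to(-\infty,\infty]$ is $p$-superharmonic if $\Delta_p u\le 0$ in the viscosity sense, that is: (1) $u$ is lower semicontinuous; (2) $u<\infty$ on a dense subset of $\mathbb{R}^n$; (3) whenever $x_0\in\mathbb{R}^n$ and $\phi$ is a $C^2$ function with $\phi(x_0)=u(x_0)$ and $\phi\le u$ near $x_0$, one has $\Delta_p\phi(x_0)\le 0$. For $C^2$ functions $\phi$ with Hessian matrix $\mathcal{H}\phi$, $$\Delta_p\phi=\operatorname{div}\left(|\nabla\phi|^{p-2}\nabla\phi\right)=|\nabla\phi|^{p-2}\Delta\phi+(p-2)|\nabla\phi|^{p-4}\sum_{i,j=1}^n\frac{\partial^2\phi}{\partial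 x_i\partial x_j}\frac{\partial\phi}{\partial x_i}\frac{\partial\phi}{\partial x_j}\qquad(2\le p<\infty),$$ where for $2<p<\infty$ the value at critical points of $\phi$ is $0$ and for $p=2$ the operator is the Laplacian, and $$\Delta_\infty\phi=\sum_{i,j=1}^n\frac{\partial^2\phi}{\partial x_i\partial x_j}\frac{\partial\phi}{\partial x_i}\frac{\partial\phi}{\partial x_j}.$$ -/

import Mathlib

open Set Filter Topology
open scoped ENNReal

noncomputable section

/-- The Hessian matrix `(∂²φ / ∂xᵢ∂xⱼ)(x)` of a function on `ℝⁿ`. -/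
def hessianMatrix {n : ℕ} (φ : EuclideanSpace ℝ (Fin n) → ℝ) (x : EuclideanSpace ℝ (Fin n)) :
    Matrix (Fin n) (Fin n) ℝ :=
  Matrix.of fun i j =>
    fderiv ℝ (fderiv ℝ φ) x (EuclideanSpace.single i 1) (EuclideanSpace.single j 1)

/-- The function `F` for which `F (∇φ) (D²φ)` is the `p`-Laplacian of `φ ∈ C²`.
For `p = ∞` it is `∑ i j, Xᵢⱼ qᵢ qⱼ`. For `2 ≤ p < ∞` it is
`|q|^(p-2) tr X + (p-2) |q|^(p-4) ∑ i j, Xᵢⱼ qᵢ qⱼ`, which comes from carrying out the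
differentiation in `div (|∇φ|^(p-2) ∇φ)`.
With the conventions of `Real.rpow`, at `q = 0` this is `tr X` if `p = 2` and `0` if `p > 2`, which
is the value of the divergence there. -/
def pLaplaceFun {n : ℕ} (p : ℝ≥0∞) (q : EuclideanSpace ℝ (Fin n))
    (X : Matrix (Fin n) (Fin n) ℝ) : ℝ :=
  if p = ⊤ then ∑ i, ∑ j, X i j * q i * q j
  else ‖q‖ ^ (p.toReal - 2) * X.trace
    + (p.toReal - 2) * ‖q‖ ^ (p.toReal - 4) * ∑ i, ∑ j, X i j * q i * q j

/-- The `C²` function `φ` touches `u` from below at `x₀`. Only the germ of `φ` at `x₀` matters, so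
`φ` is required to be `C²` near `x₀`. -/
structure TouchesFromBelow {n : ℕ} (φ : EuclideanSpace ℝ (Fin n) → ℝ)
    (u : EuclideanSpace ℝ (Fin n) → EReal) (x₀ : EuclideanSpace ℝ (Fin n)) : Prop where
  contDiffAt : ContDiffAt ℝ 2 φ x₀
  eq_at : (φ x₀ : EReal) = u x₀
  le_near : ∀ᶠ x in 𝓝 x₀, (φ x : EReal) ≤ u x

/-- `u : Ω → (-∞, ∞]` is a viscosity supersolution of `F (∇u) (D²u) = 0` in the open set `Ω`. -/
structure IsViscositySupersolution {n : ℕ}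
    (F : EuclideanSpace ℝ (Fin n) → Matrix (Fin n) (Fin n) ℝ → ℝ)
    (Ω : Set (EuclideanSpace ℝ (Fin n))) (u : EuclideanSpace ℝ (Fin n) → EReal) : Prop where
  ne_bot : ∀ x ∈ Ω, u x ≠ ⊥
  lowerSemicontinuousOn : LowerSemicontinuousOn u Ω
  dense_finite : Ω ⊆ closure {x ∈ Ω | u x < ⊤}
  le_zero : ∀ x₀ ∈ Ω, ∀ φ : EuclideanSpace ℝ (Fin n) → ℝ, TouchesFromBelow φ u x₀ →
    F (gradient φ x₀) (hessianMatrix φ x₀) ≤ 0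

/-- `u` is `p`-superharmonic in the open set `Ω`: `Δ_p u ≤ 0` in the viscosity sense. -/
def IsPSuperharmonicOn {n : ℕ} (p : ℝ≥0∞) (Ω : Set (EuclideanSpace ℝ (Fin n)))
    (u : EuclideanSpace ℝ (Fin n) → EReal) : Prop :=
  IsViscositySupersolution (pLaplaceFun p) Ω u

/-- `u` is radial: `u x = U |x|` for a one-variable function `U`. -/
def IsRadial {n : ℕ} (u : EuclideanSpace ℝ (Fin n) → EReal) : Prop :=
  ∃ U : ℝ → EReal, ∀ x, u x = U ‖x‖

end

/-! The `p`-Laplacian is nonlinear, so supersolutions cannot simply be added. With the gradient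
replaced by a fixed direction `v`, however, `dirLaplace` is linear and, for `p ≥ 2`, monotone in the
Hessian; its sign for all `v` controls the `p`-Laplacian (`pLaplaceFun_nonpos`). It is therefore
enough that radial `p`-superharmonic functions are supersolutions in every direction `v`
simultaneously.

This is `exists_touching_above`. Comparison with strict subsolutions shows that `u` decreases in the
radius and, as a function of `t = |x|^2`, is concave in `exp (-l t)` where `l t` exceeds
`expThreshold`. A supporting line in this variable is a smooth function above `u`, touching it at
`x₀`. As `l |x₀|^2` falls to the threshold, its `dirLaplace` has upper bounds tending to `0`,
uniformly over unit `v`.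

If `φ` touches the sum from below, then `∑ ψ i - φ` lies above the convex function `-K`, with
equality at `x₀`. So the Hessian of `φ` is at most the sum of those of the `ψ i`, and letting `ε →
0` gives the claim. -/

/-! ### The `p`-Laplacian with a frozen direction -/

/-- The second directional derivative of `φ` at `x` in the direction `v`. -/
noncomputable def secondDeriv {n : ℕ} (φ : EuclideanSpace ℝ (Fin n) → ℝ)
    (x v : EuclideanSpace ℝ (Fin n)) : ℝ :=
  fderiv ℝ (fderiv ℝ φ) x v v

/-- The weight of the trace term in the `p`-Laplacian. -/
noncomputable def traceWeight (p : ℝ≥0∞) : ℝ := if p = ⊤ then 0 else 1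

/-- The weight of the second derivative along the gradient in the `p`-Laplacian. -/
noncomputable def dirWeight (p : ℝ≥0∞) : ℝ := if p = ⊤ then 1 else p.toReal - 2

/-- The `p`-Laplacian with the gradient replaced by an arbitrary direction `v`, up to a positive
factor. Its supremum over unit vectors `v` is the dominative `p`-Laplacian. -/
noncomputable def dirLaplace {n : ℕ} (p : ℝ≥0∞) (v : EuclideanSpace ℝ (Fin n))
    (φ : EuclideanSpace ℝ (Fin n) → ℝ) (x : EuclideanSpace ℝ (Fin n)) : ℝ :=
  traceWeight p * ‖v‖ ^ 2 * ∑ i, secondDeriv φ x (EuclideanSpace.single i 1)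
    + dirWeight p * secondDeriv φ x v

lemma traceWeight_nonneg (p : ℝ≥0∞) : 0 ≤ traceWeight p := by
  unfold traceWeight; split_ifs <;> norm_num

lemma two_le_toReal {p : ℝ≥0∞} (hp : 2 ≤ p) (h : p ≠ ⊤) : 2 ≤ p.toReal := by
  simpa using ENNReal.toReal_mono h hp

lemma dirWeight_nonneg {p : ℝ≥0∞} (hp : 2 ≤ p) : 0 ≤ dirWeight p := by
  unfold dirWeight
  split_ifs with h
  · norm_num
  · linarith [two_le_toReal hp h]

lemma weight_add_pos {p : ℝ≥0∞} (hp : 2 ≤ p) : 0 < traceWeight p + dirWeight p := by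
  unfold traceWeight dirWeight
  split_ifs with h
  · norm_num
  · linarith [two_le_toReal hp h]

lemma trace_hessianMatrix {n : ℕ} (φ : EuclideanSpace ℝ (Fin n) → ℝ)
    (x : EuclideanSpace ℝ (Fin n)) :
    (hessianMatrix φ x).trace = ∑ i, secondDeriv φ x (EuclideanSpace.single i 1) := rfl

lemma sum_hessianMatrix_mul {n : ℕ} (φ : EuclideanSpace ℝ (Fin n) → ℝ)
    (x v : EuclideanSpace ℝ (Fin n)) :
    ∑ i, ∑ j, hessianMatrix φ x i j * v i * v j = secondDeriv φ x v := by
  have hv : v = ∑ i, v i • EuclideanSpace.single i (1 : ℝ) := by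
    ext j
    simp [Finset.sum_apply, Pi.single_apply]
  have key : ∀ L : EuclideanSpace ℝ (Fin n) →L[ℝ] EuclideanSpace ℝ (Fin n) →L[ℝ] ℝ,
      L v v = ∑ i, ∑ j,
        L (EuclideanSpace.single i 1) (EuclideanSpace.single j 1) * v i * v j := by
    intro L
    conv_lhs => rw [hv]
    simp only [map_sum, map_smul, sum_apply, smul_apply,
      smul_eq_mul, Finset.mul_sum]
    rw [Finset.sum_comm]
    refine Finset.sum_congr rfl fun i _ => Finset.sum_congr rfl fun j _ => ?_
    ring
  unfold secondDeriv
  rw [key]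
  rfl

/-- The `p`-Laplacian is a positive multiple of `dirLaplace` at the gradient. -/
lemma exists_pLaplaceFun_eq {n : ℕ} (p : ℝ≥0∞) {q : EuclideanSpace ℝ (Fin n)}
    (hq : q ≠ 0) (φ : EuclideanSpace ℝ (Fin n) → ℝ) (x : EuclideanSpace ℝ (Fin n)) :
    ∃ c > 0, pLaplaceFun p q (hessianMatrix φ x) = c * dirLaplace p q φ x := by
  unfold pLaplaceFun dirLaplace traceWeight dirWeight
  rw [trace_hessianMatrix, sum_hessianMatrix_mul]
  have hq' : 0 < ‖q‖ := norm_pos_iff.2 hq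
  split_ifs with h
  · exact ⟨1, one_pos, by ring⟩
  · refine ⟨‖q‖ ^ (p.toReal - 4), Real.rpow_pos_of_pos hq' _, ?_⟩
    have : ‖q‖ ^ (p.toReal - 2) = ‖q‖ ^ (p.toReal - 4) * ‖q‖ ^ 2 := by
      rw [← Real.rpow_natCast, ← Real.rpow_add hq']
      congr 1
      push_cast
      ring
    rw [this]
    ring

/-- For `q ≠ 0` the direction `v = q` suffices. At `q = 0` only `p = 2` matters: there the
directional weight vanishes and any unit vector recovers the trace. -/
lemma pLaplaceFun_nonpos {n : ℕ} (hn : 0 < n) {p : ℝ≥0∞}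
    (q : EuclideanSpace ℝ (Fin n)) {φ : EuclideanSpace ℝ (Fin n) → ℝ}
    {x : EuclideanSpace ℝ (Fin n)} (h : ∀ v, dirLaplace p v φ x ≤ 0) :
    pLaplaceFun p q (hessianMatrix φ x) ≤ 0 := by
  by_cases hq : q = 0
  · subst hq
    unfold pLaplaceFun
    split_ifs with hp'
    · simp
    · simp only [PiLp.zero_apply, mul_zero, Finset.sum_const_zero, add_zero, norm_zero]
      by_cases h2 : p.toReal = 2
      · have := h (EuclideanSpace.single ⟨0, hn⟩ 1)
        simp only [dirLaplace, traceWeight, dirWeight, hp', h2, if_false] at this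
        rw [trace_hessianMatrix, h2]
        simpa using this
      · rw [Real.zero_rpow (by intro h0; apply h2; linarith)]
        simp
  · obtain ⟨c, hc, he⟩ := exists_pLaplaceFun_eq p hq φ x
    rw [he]
    exact mul_nonpos_of_nonneg_of_nonpos hc.le (h q)

lemma pLaplaceFun_pos {n : ℕ} {p : ℝ≥0∞} {q : EuclideanSpace ℝ (Fin n)} (hq : q ≠ 0) {φ : EuclideanSpace ℝ (Fin n) → ℝ}
    {x : EuclideanSpace ℝ (Fin n)} (h : 0 < dirLaplace p q φ x) :
    0 < pLaplaceFun p q (hessianMatrix φ x) := by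
  obtain ⟨c, hc, he⟩ := exists_pLaplaceFun_eq p hq φ x
  rw [he]
  exact mul_pos hc h

/-! ### Derivatives of functions of `|x - z|^2` -/

section RadialDerivatives

variable {n : ℕ} {F F' : ℝ → ℝ} {c : ℝ} {z x : EuclideanSpace ℝ (Fin n)}

lemma hasFDerivAt_comp_norm_sub_sq (hF : HasDerivAt F c (‖x - z‖ ^ 2)) :
    HasFDerivAt (fun x => F (‖x - z‖ ^ 2)) ((2 * c) • innerSL ℝ (x - z)) x := by
  have h1 : HasFDerivAt (fun x => ‖x - z‖ ^ 2) _ x := ((hasFDerivAt_id x).sub_const z).norm_sq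
  have h2 := hF.comp_hasFDerivAt x h1
  refine h2.congr_fderiv ?_
  ext v
  simp only [smul_apply, ContinuousLinearMap.comp_apply, ContinuousLinearMap.id_apply,
    innerSL_apply_apply, smul_eq_mul, nsmul_eq_mul, id]
  push_cast
  ring

lemma gradient_comp_norm_sub_sq (hF : HasDerivAt F c (‖x - z‖ ^ 2)) :
    gradient (fun x => F (‖x - z‖ ^ 2)) x = (2 * c) • (x - z) := by
  unfold gradient
  rw [(hasFDerivAt_comp_norm_sub_sq hF).fderiv]
  apply (InnerProductSpace.toDual ℝ _).injective
  ext v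
  simp

lemma secondDeriv_comp_norm_sub_sq (hF : ∀ t, HasDerivAt F (F' t) t)
    (hF' : HasDerivAt F' c (‖x - z‖ ^ 2)) (v : EuclideanSpace ℝ (Fin n)) :
    secondDeriv (fun x => F (‖x - z‖ ^ 2)) x v
      = 2 * F' (‖x - z‖ ^ 2) * ‖v‖ ^ 2 + 4 * c * (inner ℝ (x - z) v) ^ 2 := by
  have h1 : fderiv ℝ (fun x => F (‖x - z‖ ^ 2))
      = fun x => (2 * F' (‖x - z‖ ^ 2)) • innerSL ℝ (x - z) :=
    funext fun x => (hasFDerivAt_comp_norm_sub_sq (hF _)).fderiv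
  have h2 : HasFDerivAt (fun x => innerSL ℝ (x - z)) (innerSL ℝ) x := by
    have := ((innerSL ℝ (E := EuclideanSpace ℝ (Fin n))).hasFDerivAt (x := x - z)).comp x
      ((hasFDerivAt_id x).sub_const z)
    exact this.congr_fderiv (by ext; simp)
  have h3 := ((hasFDerivAt_comp_norm_sub_sq hF').const_mul 2).fun_smul h2
  unfold secondDeriv
  rw [h1, h3.fderiv]
  simp only [add_apply, smul_apply, ContinuousLinearMap.smulRight_apply, innerSL_apply_apply,
    smul_eq_mul]
  change 2 * F' (‖x - z‖ ^ 2) * inner ℝ v v + _ = _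
  rw [real_inner_self_eq_norm_sq]
  ring

/-- Used both with `v` the gradient, to get strict subsolutions, and with arbitrary `v`, to bound
the touching functions from above. -/
lemma dirLaplace_comp_norm_sub_sq (p : ℝ≥0∞) (hF : ∀ t, HasDerivAt F (F' t) t)
    (hF' : HasDerivAt F' c (‖x - z‖ ^ 2)) (v : EuclideanSpace ℝ (Fin n)) :
    dirLaplace p v (fun x => F (‖x - z‖ ^ 2)) x
      = 2 * (n * traceWeight p + dirWeight p) * F' (‖x - z‖ ^ 2) * ‖v‖ ^ 2
        + 4 * c * (traceWeight p * ‖x - z‖ ^ 2 * ‖v‖ ^ 2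
          + dirWeight p * (inner ℝ (x - z) v) ^ 2) := by
  unfold dirLaplace
  simp only [secondDeriv_comp_norm_sub_sq hF hF']
  have : ∑ i, (inner ℝ (x - z) (EuclideanSpace.single i 1)) ^ 2 = ‖x - z‖ ^ 2 := by
    rw [EuclideanSpace.norm_sq_eq]
    exact Finset.sum_congr rfl fun i _ => by
      rw [EuclideanSpace.inner_single_right]
      simp
  rw [Finset.sum_add_distrib, ← Finset.mul_sum Finset.univ (fun i => _ ^ 2) (4 * c), this]
  simp
  ring

end RadialDerivatives

/-! ### Second order condition and comparison principle -/

/-- Second order necessary condition, for even second differences. -/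
lemma secondDeriv_nonneg_of_second_difference {n : ℕ} {f : EuclideanSpace ℝ (Fin n) → ℝ}
    {x v : EuclideanSpace ℝ (Fin n)} (hf : ContDiffAt ℝ 2 f x)
    (h : ∀ᶠ s : ℝ in 𝓝 0, 2 * f x ≤ f (x + s • v) + f (x - s • v)) :
    0 ≤ secondDeriv f x v := by
  set g : ℝ → ℝ := fun s => f (x + s • v) + f (x - s • v) with hg
  have hd : ∀ᶠ y in 𝓝 x, HasFDerivAt f (fderiv ℝ f y) y := by
    filter_upwards [hf.eventually (by simp)] with y hy
    exact (hy.differentiableAt (by norm_num)).hasFDerivAt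
  have hL : ∀ w : EuclideanSpace ℝ (Fin n), ∀ s : ℝ,
      HasDerivAt (fun s : ℝ => x + s • w) w s := fun w s => by
    simpa using ((hasDerivAt_id s).smul_const w).const_add x
  have hT : ∀ w : EuclideanSpace ℝ (Fin n), Tendsto (fun s : ℝ => x + s • w) (𝓝 0) (𝓝 x) :=
    fun w => by simpa using (hL w 0).continuousAt.tendsto
  have hg' : ∀ᶠ s in 𝓝 (0 : ℝ),
      HasDerivAt g (fderiv ℝ f (x + s • v) v - fderiv ℝ f (x - s • v) v) s := by
    filter_upwards [(hT v).eventually hd, (hT (-v)).eventually hd] with s h1 h2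
    have := (h1.comp_hasDerivAt s (hL v s)).fun_add (h2.comp_hasDerivAt s (hL (-v) s))
    simpa [hg, ← sub_eq_add_neg, Function.comp_def] using this
  have hdg : deriv g =ᶠ[𝓝 0] fun s => fderiv ℝ f (x + s • v) v - fderiv ℝ f (x - s • v) v :=
    hg'.mono fun s hs => hs.deriv
  have hd0 : deriv g 0 = 0 := by simpa using hdg.self_of_nhds
  have h2 : HasFDerivAt (fderiv ℝ f) (fderiv ℝ (fderiv ℝ f) x) x :=
    ((hf.fderiv_right (m := 1) (by norm_num)).differentiableAt (by norm_num)).hasFDerivAt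
  have hdd : HasDerivAt (deriv g) (2 * secondDeriv f x v) 0 := by
    refine HasDerivAt.congr_of_eventuallyEq ?_ hdg
    have hc : ∀ w, HasDerivAt (fun s : ℝ => fderiv ℝ f (x + s • w) v)
        (fderiv ℝ (fderiv ℝ f) x w v) 0 := fun w => by
      have h3 : HasFDerivAt (fderiv ℝ f) (fderiv ℝ (fderiv ℝ f) x) (x + (0 : ℝ) • w) := by
        simpa using h2
      have h4 : HasDerivAt (fun s : ℝ => fderiv ℝ f (x + s • w)) (fderiv ℝ (fderiv ℝ f) x w) 0 :=
        h3.comp_hasDerivAt (0 : ℝ) (hL w 0)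
      exact ((ContinuousLinearMap.apply ℝ ℝ v).hasFDerivAt).comp_hasDerivAt (0 : ℝ) h4
    have := (hc v).fun_sub (hc (-v))
    simp only [smul_neg, ← sub_eq_add_neg] at this
    refine this.congr_deriv ?_
    rw [map_neg, neg_apply, sub_neg_eq_add, secondDeriv, two_mul]
  have hmin : IsLocalMin g 0 := by
    filter_upwards [h] with s hs
    simpa [hg, two_mul] using hs
  have hcont : ContinuousAt g 0 := hg'.self_of_nhds.continuousAt
  -- If the second derivative were negative, `0` would be a local maximum of `g` as well as a local
  -- minimum, so `g` would be locally constant and the second derivative zero.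
  by_contra! hneg
  have hmax : IsLocalMin (fun s => -g s) 0 := by
    apply isLocalMin_of_deriv_deriv_pos
    · have : deriv (fun s => -g s) = fun s => -deriv g s := by ext s; exact deriv.fun_neg
      rw [this, deriv.fun_neg, hdd.deriv]
      linarith
    · rw [deriv.fun_neg, hd0, neg_zero]
    · exact hcont.neg
  have hconst : g =ᶠ[𝓝 0] fun _ => g 0 := by
    filter_upwards [hmin, hmax] with s h1 h2
    linarith
  have h0 : deriv (deriv g) 0 = 0 := by
    have := hconst.deriv.deriv_eq
    simpa using this
  rw [hdd.deriv] at h0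
  linarith

lemma hessianMatrix_add_const {n : ℕ} (φ : EuclideanSpace ℝ (Fin n) → ℝ) (m : ℝ)
    (x : EuclideanSpace ℝ (Fin n)) :
    hessianMatrix (fun x => φ x + m) x = hessianMatrix φ x := by
  have : fderiv ℝ (fun x => φ x + m) = fderiv ℝ φ := by
    ext1 x
    exact fderiv_add_const m
  simp only [hessianMatrix, this]

lemma gradient_add_const {n : ℕ} (φ : EuclideanSpace ℝ (Fin n) → ℝ) (m : ℝ)
    (x : EuclideanSpace ℝ (Fin n)) :
    gradient (fun x => φ x + m) x = gradient φ x := by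
  simp only [gradient, fderiv_add_const]

/-- Comparison of a viscosity supersolution with a strict classical subsolution. -/
lemma IsViscositySupersolution.ge_of_strict_subsolution {n : ℕ}
    {F : EuclideanSpace ℝ (Fin n) → Matrix (Fin n) (Fin n) ℝ → ℝ}
    {u : EuclideanSpace ℝ (Fin n) → EReal} (hu : IsViscositySupersolution F univ u)
    {C : Set (EuclideanSpace ℝ (Fin n))} (hC : IsCompact C)
    {φ : EuclideanSpace ℝ (Fin n) → ℝ} (hφ : ContDiff ℝ 2 φ)
    (h : ∀ x ∈ C, (φ x : EReal) ≤ u x ∨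
      (C ∈ 𝓝 x ∧ 0 < F (gradient φ x) (hessianMatrix φ x))) :
    ∀ x ∈ C, (φ x : EReal) ≤ u x := by
  intro x hx
  have hlsc : LowerSemicontinuous fun x => u x + ((-φ x : ℝ) : EReal) := by
    refine (lowerSemicontinuousOn_univ_iff.1 hu.lowerSemicontinuousOn).add' ?_ fun x =>
      EReal.continuousAt_add (Or.inr (EReal.coe_ne_bot _)) (Or.inr (EReal.coe_ne_top _))
    exact (continuous_coe_real_ereal.comp hφ.continuous.neg).lowerSemicontinuous
  obtain ⟨a, ha, hmin⟩ := (hlsc.lowerSemicontinuousOn C).exists_isMinOn ⟨x, hx⟩ hC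
  have hmin : ∀ y ∈ C, u a + ((-φ a : ℝ) : EReal) ≤ u y + ((-φ y : ℝ) : EReal) := hmin
  have hreal : ∀ w : ℝ, u a = w → ∀ y ∈ C, ((φ y + (w - φ a) : ℝ) : EReal) ≤ u y := by
    intro w hw y hy
    have h1 := hmin y hy
    rw [hw] at h1
    rcases eq_or_ne (u y) ⊤ with ht | ht
    · rw [ht]; exact le_top
    · lift u y to ℝ using ⟨ht, hu.ne_bot y (mem_univ y)⟩ with v
      norm_cast at h1 ⊢
      linarith
  by_cases hat : u a = ⊤
  · have h1 := hmin x hx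
    rw [hat, EReal.top_add_coe, top_le_iff] at h1
    have : u x = ⊤ := by
      by_contra hne
      lift u x to ℝ using ⟨hne, hu.ne_bot x (mem_univ x)⟩ with v
      exact EReal.coe_ne_top (v + -φ x) (by exact_mod_cast h1)
    rw [this]; exact le_top
  · obtain ⟨w, hw⟩ : ∃ w : ℝ, u a = w :=
      ⟨(u a).toReal, (EReal.coe_toReal hat (hu.ne_bot a (mem_univ a))).symm⟩
    have hle := hreal w hw
    suffices hwa : φ a ≤ w from le_trans (by norm_cast; linarith) (hle x hx)
    -- A negative minimum of `u - φ` lies where the strict inequality holds, and there `φ` shifted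
    -- by a constant touches `u` from below.
    by_contra! hlt
    rcases h a ha with h1 | ⟨hnhds, hpos⟩
    · rw [hw] at h1
      exact absurd (EReal.coe_le_coe_iff.1 h1) (not_le.2 hlt)
    · have := hu.le_zero a (mem_univ a) (fun x => φ x + (w - φ a))
        ⟨(hφ.add contDiff_const).contDiffAt, by rw [hw]; norm_cast; ring,
          by filter_upwards [hnhds] with y hy using hle y hy⟩
      rw [hessianMatrix_add_const, gradient_add_const] at this
      linarith

/-! ### Monotonicity in the radius -/

lemma exists_norm_eq_of_pos {n : ℕ} (hn : 0 < n) {r : ℝ} (hr : 0 ≤ r) :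
    ∃ x : EuclideanSpace ℝ (Fin n), ‖x‖ = r :=
  ⟨EuclideanSpace.single ⟨0, hn⟩ r, by simp [abs_of_nonneg hr]⟩

lemma IsRadial.congr {n : ℕ} {u : EuclideanSpace ℝ (Fin n) → EReal} (h : IsRadial u)
    {x y : EuclideanSpace ℝ (Fin n)} (hxy : ‖x‖ = ‖y‖) : u x = u y := by
  obtain ⟨U, hU⟩ := h
  rw [hU, hU, hxy]

/-- A paraboloid with its vertex outside the ball shows that radial `p`-superharmonic functions
decrease in the radius. -/
lemma IsPSuperharmonicOn.antitone_norm {n : ℕ} (hn : 0 < n) {p : ℝ≥0∞} (hp : 2 ≤ p)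
    {u : EuclideanSpace ℝ (Fin n) → EReal} (hu : IsPSuperharmonicOn p univ u)
    (hr : IsRadial u) {x y : EuclideanSpace ℝ (Fin n)} (hxy : ‖x‖ ≤ ‖y‖) : u y ≤ u x := by
  refine EReal.ge_of_forall_gt_iff_ge.1 fun c hc => ?_
  set r := ‖y‖
  have hr0 : 0 ≤ r := norm_nonneg y
  -- With the vertex off the ball the gradient never vanishes there; `M` bounds the squared distance
  -- to `z`, so the paraboloid stays below `c` on the ball.
  obtain ⟨z, hz⟩ := exists_norm_eq_of_pos hn (by linarith : 0 ≤ r + 1)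
  set M := (2 * r + 1) ^ 2
  have hM : 0 < M := by positivity
  have hw : 0 < n * traceWeight p + dirWeight p := by
    have h1 : (1 : ℝ) ≤ n := by exact_mod_cast hn
    nlinarith [weight_add_pos hp, traceWeight_nonneg p]
  have key : ∀ ε : ℝ, 0 < ε → ((c - ε * M : ℝ) : EReal) ≤ u x := by
    intro ε hε
    have hF : ∀ t : ℝ, HasDerivAt (fun t => c - ε * M + ε * t) ε t := fun t => by
      simpa using ((hasDerivAt_id t).const_mul ε).const_add (c - ε * M)
    have hcomp := hu.ge_of_strict_subsolution
      (isCompact_closedBall (0 : EuclideanSpace ℝ (Fin n)) r)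
      (φ := fun x => c - ε * M + ε * ‖x - z‖ ^ 2) ?_ ?_ x (by simpa using hxy)
    · refine le_trans ?_ hcomp
      norm_cast
      nlinarith [sq_nonneg ‖x - z‖]
    · exact contDiff_const.add (contDiff_const.mul ((contDiff_id.sub contDiff_const).norm_sq ℝ))
    · intro a ha
      have ha : ‖a‖ ≤ r := by simpa using ha
      rcases ha.eq_or_lt with h | h
      · left
        rw [hr.congr (h : ‖a‖ = ‖y‖)]
        refine le_trans ?_ hc.le
        have h1 : ‖a - z‖ ≤ 2 * r + 1 := (norm_sub_le a z).trans (by linarith)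
        have h2 : ‖a - z‖ ^ 2 ≤ M := pow_le_pow_left₀ (norm_nonneg _) h1 2
        norm_cast
        nlinarith
      · right
        have haz : a - z ≠ 0 := by
          rw [sub_ne_zero]
          rintro rfl
          linarith
        have hq : (2 * ε) • (a - z) ≠ 0 := smul_ne_zero (by positivity) haz
        refine ⟨Metric.closedBall_mem_nhds_of_mem (by simpa using h), ?_⟩
        rw [gradient_comp_norm_sub_sq (F := fun t => c - ε * M + ε * t) (hF _)]
        refine pLaplaceFun_pos hq ?_
        rw [dirLaplace_comp_norm_sub_sq (F := fun t => c - ε * M + ε * t) p hF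
          (hasDerivAt_const _ _)]
        have := norm_pos_iff.2 hq
        simp only [mul_zero, zero_mul, add_zero]
        positivity
  rcases eq_or_ne (u x) ⊤ with ht | ht
  · rw [ht]; exact le_top
  · lift u x to ℝ using ⟨ht, hu.ne_bot x (mem_univ x)⟩ with v
    norm_cast
    by_contra! hlt
    have := key ((c - v) / (2 * M)) (div_pos (by linarith) (by positivity))
    norm_cast at this
    have h2 : (c - v) / (2 * M) * M = (c - v) / 2 := by field_simp
    linarith

/-! ### Exponential barriers -/

/-- The critical value of `λ |x| ^ 2` above which `exp (-λ |x| ^ 2)` is strictly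
`p`-subharmonic. -/
noncomputable def expThreshold (n : ℕ) (p : ℝ≥0∞) : ℝ :=
  (n * traceWeight p + dirWeight p) / (2 * (traceWeight p + dirWeight p))

lemma expThreshold_pos {n : ℕ} (hn : 0 < n) {p : ℝ≥0∞} (hp : 2 ≤ p) : 0 < expThreshold n p := by
  have h1 : (1 : ℝ) ≤ n := by exact_mod_cast hn
  have h2 := weight_add_pos hp
  exact div_pos (by nlinarith [traceWeight_nonneg p]) (by linarith)

lemma expThreshold_mul {n : ℕ} {p : ℝ≥0∞} (hp : 2 ≤ p) :
    n * traceWeight p + dirWeight p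
      = expThreshold n p * (2 * (traceWeight p + dirWeight p)) := by
  have h2 := weight_add_pos hp
  unfold expThreshold
  field_simp

section ExpBarrier

variable (a b l t : ℝ)

lemma hasDerivAt_exp_barrier :
    HasDerivAt (fun t => a + b * Real.exp (-(l * t))) (-(l * b * Real.exp (-(l * t)))) t := by
  have := ((((hasDerivAt_id t).const_mul l).neg.exp).const_mul b).const_add a
  refine this.congr_deriv ?_
  simp
  ring

lemma hasDerivAt_exp_barrier_deriv :
    HasDerivAt (fun t => -(l * b * Real.exp (-(l * t)))) (l ^ 2 * b * Real.exp (-(l * t))) t := by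
  have := ((((hasDerivAt_id t).const_mul l).neg.exp).const_mul (l * b)).neg
  refine this.congr_deriv ?_
  simp
  ring

lemma contDiff_exp_barrier {n : ℕ} :
    ContDiff ℝ 2 fun x : EuclideanSpace ℝ (Fin n) => a + b * Real.exp (-(l * ‖x - 0‖ ^ 2)) :=
  contDiff_const.add (contDiff_const.mul
    (contDiff_const.mul ((contDiff_id.sub contDiff_const).norm_sq ℝ)).neg.exp)

end ExpBarrier

/-- Comparison of radial `p`-superharmonic functions with `a + b exp (-l |x| ^ 2)` on annuli. -/
lemma IsPSuperharmonicOn.exp_barrier_le {n : ℕ} {p : ℝ≥0∞} (hn : 0 < n) (hp : 2 ≤ p)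
    {u : EuclideanSpace ℝ (Fin n) → EReal} (hu : IsPSuperharmonicOn p univ u)
    (hr : IsRadial u) {x₁ x x₃ : EuclideanSpace ℝ (Fin n)} (h₁ : ‖x₁‖ ≤ ‖x‖) (h₃ : ‖x‖ ≤ ‖x₃‖)
    {a b l : ℝ} (hb : 0 < b) (hl : 0 < l) (hlx : expThreshold n p ≤ l * ‖x₁‖ ^ 2)
    (hu₁ : ((a + b * Real.exp (-(l * ‖x₁‖ ^ 2)) : ℝ) : EReal) ≤ u x₁)
    (hu₃ : ((a + b * Real.exp (-(l * ‖x₃‖ ^ 2)) : ℝ) : EReal) ≤ u x₃) :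
    ((a + b * Real.exp (-(l * ‖x‖ ^ 2)) : ℝ) : EReal) ≤ u x := by
  have hκ := expThreshold_pos hn hp
  have hcomp := hu.ge_of_strict_subsolution
    (C := Metric.closedBall 0 ‖x₃‖ ∩ {y | ‖x₁‖ ≤ ‖y‖})
    ((isCompact_closedBall _ _).inter_right (isClosed_le continuous_const continuous_norm))
    (contDiff_exp_barrier a b l) ?_ x ⟨by simpa using h₃, h₁⟩
  · simpa using hcomp
  · rintro y ⟨hy3, hy1⟩
    have hy3 : ‖y‖ ≤ ‖x₃‖ := by simpa using hy3
    have hy1 : ‖x₁‖ ≤ ‖y‖ := hy1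
    rcases hy3.eq_or_lt with h | hy3
    · left
      rw [hr.congr h, sub_zero, h]
      exact hu₃
    rcases hy1.eq_or_lt with h | hy1
    · left
      rw [← hr.congr h, sub_zero, ← h]
      exact hu₁
    right
    refine ⟨inter_mem (Metric.closedBall_mem_nhds_of_mem (by simpa using hy3)) ?_, ?_⟩
    · filter_upwards [(isOpen_lt continuous_const continuous_norm).mem_nhds hy1] with w hw
      exact le_of_lt hw
    · have hF := hasDerivAt_exp_barrier a b l
      have hF' := hasDerivAt_exp_barrier_deriv b l
      have hyp : 0 < ‖y‖ := (norm_nonneg _).trans_lt hy1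
      have hE : 0 < Real.exp (-(l * ‖y - 0‖ ^ 2)) := Real.exp_pos _
      have hq : (2 * -(l * b * Real.exp (-(l * ‖y - 0‖ ^ 2)))) • (y - 0) ≠ 0 := by
        refine smul_ne_zero ?_ (by simpa using hyp)
        have : 0 < l * b * Real.exp (-(l * ‖y - 0‖ ^ 2)) := by positivity
        linarith
      rw [gradient_comp_norm_sub_sq (F := fun t => a + b * Real.exp (-(l * t))) (hF _)]
      refine pLaplaceFun_pos hq ?_
      rw [dirLaplace_comp_norm_sub_sq p hF (hF' _), expThreshold_mul hp, sub_zero]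
      rw [sub_zero] at hE
      set E := Real.exp (-(l * ‖y‖ ^ 2))
      rw [norm_smul, real_inner_smul_right, real_inner_self_eq_norm_sq, mul_pow,
        Real.norm_eq_abs, sq_abs]
      have hlt : expThreshold n p < l * ‖y‖ ^ 2 :=
        hlx.trans_lt (mul_lt_mul_of_pos_left (pow_lt_pow_left₀ hy1 (norm_nonneg _) two_ne_zero) hl)
      -- This is exactly `dirLaplace` in the gradient direction, which is parallel to `y`.
      have hpos : 0 < 16 * (traceWeight p + dirWeight p) * (l * b * E) ^ 3 * ‖y‖ ^ 2
          * (l * ‖y‖ ^ 2 - expThreshold n p) :=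
        mul_pos (by have := weight_add_pos hp; positivity) (by linarith)
      refine hpos.trans_le (le_of_eq ?_)
      ring

/-- A radial `p`-superharmonic function can be infinite at the origin only. -/
lemma IsPSuperharmonicOn.ne_top_of_ne_zero {n : ℕ} {p : ℝ≥0∞} (hn : 0 < n) (hp : 2 ≤ p)
    {u : EuclideanSpace ℝ (Fin n) → EReal} (hu : IsPSuperharmonicOn p univ u)
    (hr : IsRadial u) {x : EuclideanSpace ℝ (Fin n)} (hx : x ≠ 0) : u x ≠ ⊤ := by
  intro htop
  have hxp : 0 < ‖x‖ := norm_pos_iff.2 hx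
  obtain ⟨x₁, hx₁, hfin⟩ : ∃ x₁ : EuclideanSpace ℝ (Fin n), ‖x‖ < ‖x₁‖ ∧ u x₁ < ⊤ := by
    obtain ⟨w, hw⟩ := exists_norm_eq_of_pos hn (by linarith : 0 ≤ ‖x‖ + 1)
    have := mem_closure_iff.1 (hu.dense_finite (mem_univ w)) {y | ‖x‖ < ‖y‖}
      (isOpen_lt continuous_const continuous_norm) (by simp [hw])
    obtain ⟨y, hy1, hy2⟩ := this
    exact ⟨y, hy1, hy2.2⟩
  obtain ⟨x₃, hx₃⟩ := exists_norm_eq_of_pos hn (by linarith [norm_nonneg x₁] : 0 ≤ ‖x₁‖ + 1)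
  obtain ⟨c, hc⟩ : ∃ c : ℝ, (c : EReal) ≤ u x₃ :=
    (EReal.lt_iff_exists_real_btwn.1 (bot_lt_iff_ne_bot.2 (hu.ne_bot x₃ (mem_univ _)))).imp
      fun c h => h.2.le
  lift u x₁ to ℝ using ⟨hfin.ne, hu.ne_bot x₁ (mem_univ _)⟩ with v hv
  have hκ := expThreshold_pos hn hp
  set l := expThreshold n p / ‖x‖ ^ 2 with hl
  have hlp : 0 < l := by positivity
  set d := Real.exp (-(l * ‖x₁‖ ^ 2)) - Real.exp (-(l * ‖x₃‖ ^ 2)) with hd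
  have hdpos : 0 < d := by
    have : ‖x₁‖ ^ 2 < ‖x₃‖ ^ 2 := pow_lt_pow_left₀ (by linarith) (norm_nonneg _) two_ne_zero
    have := Real.exp_lt_exp.2 (neg_lt_neg (mul_lt_mul_of_pos_left this hlp))
    linarith
  -- Since `u = ⊤` on the inner sphere, `b` is unrestricted; this choice gives the barrier the value
  -- `c + |v - c| + 1 > v` at `x₁`.
  set b := (|v - c| + 1) / d with hb
  have hbp : 0 < b := by positivity
  have := hu.exp_barrier_le hn hp hr (x₁ := x) (x := x₁) (x₃ := x₃) hx₁.le (by linarith)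
    (a := c - b * Real.exp (-(l * ‖x₃‖ ^ 2))) hbp hlp (by rw [hl]; field_simp; rfl)
    (by rw [htop]; exact le_top) (le_trans (by norm_cast; linarith) hc)
  rw [← hv] at this
  norm_cast at this
  have h2 : b * d = |v - c| + 1 := by rw [hb]; field_simp
  rw [hd] at h2
  nlinarith [le_abs_self (v - c)]

/-! ### Supporting lines and smooth functions touching from above -/

/-- A decreasing function that is concave as a function of the strictly decreasing function `e` has
supporting lines in terms of `e`. -/
lemma exists_supporting_slope {g e : ℝ → ℝ} {τ t₀ : ℝ} (ht₀ : τ < t₀) (he : StrictAnti e)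
    (hg : ∀ s t, τ < s → s ≤ t → g t ≤ g s)
    (hconc : ∀ t₁ t t₃ a b, τ < t₁ → t₁ ≤ t → t ≤ t₃ → 0 < b → a + b * e t₁ ≤ g t₁ →
      a + b * e t₃ ≤ g t₃ → a + b * e t ≤ g t) :
    ∃ b, 0 ≤ b ∧ ∀ t, τ < t → g t ≤ g t₀ + b * (e t - e t₀) := by
  have slope : ∀ t₁ t₃, τ < t₁ → t₁ < t₀ → t₀ < t₃ →
      (g t₁ - g t₀) / (e t₁ - e t₀) ≤ (g t₀ - g t₃) / (e t₀ - e t₃) := by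
    intro t₁ t₃ h1 h10 h03
    have e1 := he h10
    have e3 := he h03
    set B := (g t₁ - g t₃) / (e t₁ - e t₃) with hB
    have hBm : B * (e t₁ - e t₃) = g t₁ - g t₃ := by
      rw [hB, div_mul_cancel₀]; linarith
    have hB0 : 0 ≤ B :=
      div_nonneg (by linarith [hg t₁ t₃ h1 (by linarith)]) (by linarith)
    have hmid : g t₃ + B * (e t₀ - e t₃) ≤ g t₀ := by
      -- The concavity hypothesis needs a positive slope; for slope zero monotonicity does the work.
      rcases hB0.eq_or_lt with h | h
      · rw [← h]
        linarith [hg t₀ t₃ ht₀ h03.le]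
      · have := hconc t₁ t₀ t₃ (g t₃ - B * e t₃) B h1 h10.le h03.le h (by linarith)
          (by linarith)
        linarith
    trans B
    · rw [div_le_iff₀ (by linarith)]; linarith
    · rw [le_div_iff₀ (by linarith)]; linarith
  -- Chord slopes to the left of `t₀` never exceed those to the right, so their supremum is a
  -- supporting slope.
  set S := (fun t => (g t - g t₀) / (e t - e t₀)) '' Ioo τ t₀ with hS
  have hne : S.Nonempty := (nonempty_Ioo.2 ht₀).image _
  have hbd : BddAbove S := by
    refine ⟨(g t₀ - g (t₀ + 1)) / (e t₀ - e (t₀ + 1)), ?_⟩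
    rintro _ ⟨t, ht, rfl⟩
    exact slope t _ ht.1 ht.2 (by linarith)
  refine ⟨sSup S, ?_, fun t ht => ?_⟩
  · obtain ⟨_, ⟨t, ht, rfl⟩⟩ := hne
    refine le_trans ?_ (le_csSup hbd ⟨t, ht, rfl⟩)
    exact div_nonneg (by linarith [hg t t₀ ht.1 ht.2.le]) (by linarith [he ht.2])
  · rcases lt_trichotomy t t₀ with h | rfl | h
    · have := le_csSup hbd ⟨t, ⟨ht, h⟩, rfl⟩
      rw [div_le_iff₀ (by linarith [he h])] at this
      linarith
    · simp
    · have : sSup S ≤ (g t₀ - g t) / (e t₀ - e t) := by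
        refine csSup_le hne ?_
        rintro _ ⟨s, hs, rfl⟩
        exact slope s t hs.1 hs.2 h
      rw [le_div_iff₀ (by linarith [he h])] at this
      linarith

lemma secondDeriv_const {n : ℕ} (c : ℝ) (x v : EuclideanSpace ℝ (Fin n)) :
    secondDeriv (fun _ => c) x v = 0 := by
  have : fderiv ℝ (fun _ : EuclideanSpace ℝ (Fin n) => c) = fun _ => 0 := by
    ext1 x
    exact fderiv_const_apply c
  simp [secondDeriv, this]

lemma secondDeriv_comp_sub_const {n : ℕ} (φ : EuclideanSpace ℝ (Fin n) → ℝ)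
    (x y v : EuclideanSpace ℝ (Fin n)) :
    secondDeriv (fun x => φ (x - y)) x v = secondDeriv φ (x - y) v := by
  have : fderiv ℝ (fun x => φ (x - y)) = fun x => fderiv ℝ φ (x - y) := by
    ext1 x
    exact fderiv_comp_sub y
  rw [secondDeriv, this, secondDeriv, fderiv_comp_sub y]

lemma secondDeriv_sub {n : ℕ} {f g : EuclideanSpace ℝ (Fin n) → ℝ}
    {x : EuclideanSpace ℝ (Fin n)} (hf : ContDiffAt ℝ 2 f x) (hg : ContDiffAt ℝ 2 g x)
    (v : EuclideanSpace ℝ (Fin n)) :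
    secondDeriv (fun x => f x - g x) x v = secondDeriv f x v - secondDeriv g x v := by
  have h : fderiv ℝ (fun x => f x - g x) =ᶠ[𝓝 x] fun x => fderiv ℝ f x - fderiv ℝ g x := by
    filter_upwards [hf.eventually (by simp), hg.eventually (by simp)] with y h1 h2
    exact fderiv_fun_sub (h1.differentiableAt (by norm_num)) (h2.differentiableAt (by norm_num))
  have hd : ∀ {f : EuclideanSpace ℝ (Fin n) → ℝ}, ContDiffAt ℝ 2 f x →
      DifferentiableAt ℝ (fderiv ℝ f) x := fun hf =>
    (hf.fderiv_right (m := 1) (by norm_num)).differentiableAt (by norm_num)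
  rw [secondDeriv, h.fderiv_eq, fderiv_fun_sub (hd hf) (hd hg)]
  rfl

lemma secondDeriv_sum {n : ℕ} {ι : Type*} (s : Finset ι)
    {f : ι → EuclideanSpace ℝ (Fin n) → ℝ} (hf : ∀ i, ContDiff ℝ 2 (f i))
    (x v : EuclideanSpace ℝ (Fin n)) :
    secondDeriv (fun x => ∑ i ∈ s, f i x) x v = ∑ i ∈ s, secondDeriv (f i) x v := by
  have h : fderiv ℝ (fun x => ∑ i ∈ s, f i x) = fun x => ∑ i ∈ s, fderiv ℝ (f i) x := by
    ext1 x
    exact fderiv_fun_sum fun i _ => ((hf i).differentiable (by norm_num)) x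
  rw [secondDeriv, h, fderiv_fun_sum fun i _ =>
    (((hf i).fderiv_right (m := 1) (by norm_num)).differentiable (by norm_num)) x]
  simp [secondDeriv]

/-- A bound for `dirLaplace` on the barrier `a + b exp (-l |x| ^ 2)`. -/
lemma dirLaplace_exp_barrier_le {n : ℕ} {p : ℝ≥0∞} (hp : 2 ≤ p) {a b l : ℝ} (hb : 0 ≤ b)
    (x v : EuclideanSpace ℝ (Fin n)) :
    dirLaplace p v (fun x => a + b * Real.exp (-(l * ‖x - 0‖ ^ 2))) x
      ≤ 4 * (traceWeight p + dirWeight p) * (l * b * Real.exp (-(l * ‖x‖ ^ 2)))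
        * (l * ‖x‖ ^ 2 - expThreshold n p) * ‖v‖ ^ 2 := by
  rw [dirLaplace_comp_norm_sub_sq p (hasDerivAt_exp_barrier a b l)
    (hasDerivAt_exp_barrier_deriv b l _), expThreshold_mul hp, sub_zero]
  have h1 : (inner ℝ x v) ^ 2 ≤ ‖x‖ ^ 2 * ‖v‖ ^ 2 := by
    rw [← mul_pow, ← sq_abs (inner ℝ x v)]
    exact pow_le_pow_left₀ (abs_nonneg _) (abs_real_inner_le_norm x v) 2
  have h2 : 0 ≤ 4 * (l ^ 2 * b * Real.exp (-(l * ‖x‖ ^ 2))) * dirWeight p := by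
    have := dirWeight_nonneg hp
    positivity
  nlinarith [mul_le_mul_of_nonneg_left h1 h2]

/-- Wherever it is finite, a radial `p`-superharmonic function is touched from above by smooth
functions whose dominative `p`-Laplacian is almost nonpositive. -/
lemma IsPSuperharmonicOn.exists_touching_above {n : ℕ} {p : ℝ≥0∞} (hn : 0 < n) (hp : 2 ≤ p)
    {u : EuclideanSpace ℝ (Fin n) → EReal} (hu : IsPSuperharmonicOn p univ u)
    (hr : IsRadial u) {x₀ : EuclideanSpace ℝ (Fin n)} (hfin : u x₀ ≠ ⊤) {ε : ℝ} (hε : 0 < ε) :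
    ∃ ψ : EuclideanSpace ℝ (Fin n) → ℝ, ContDiff ℝ 2 ψ ∧ (ψ x₀ : EReal) = u x₀ ∧
      (∀ᶠ x in 𝓝 x₀, u x ≤ ψ x) ∧ ∀ v, dirLaplace p v ψ x₀ ≤ ε * ‖v‖ ^ 2 := by
  have hx₀u : ((u x₀).toReal : EReal) = u x₀ := EReal.coe_toReal hfin (hu.ne_bot x₀ (mem_univ _))
  by_cases hx₀ : x₀ = 0
  · refine ⟨fun _ => (u x₀).toReal, contDiff_const, hx₀u, Eventually.of_forall fun x => ?_,
      fun v => ?_⟩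
    · rw [hx₀u]
      exact hu.antitone_norm hn hp hr (by simp [hx₀])
    · simp only [dirLaplace, secondDeriv_const]
      simp
      positivity
  choose X hX using fun t : ℝ => exists_norm_eq_of_pos hn (Real.sqrt_nonneg t)
  have hX2 : ∀ t, 0 < t → ‖X t‖ ^ 2 = t := fun t ht => by rw [hX, Real.sq_sqrt ht.le]
  -- The profile of `u` in `t = |x|^2`. Only `t > 0` is used: `u` may be infinite at the origin.
  set g : ℝ → ℝ := fun t => (u (X t)).toReal with hgdef
  have hg : ∀ t, 0 < t → (g t : EReal) = u (X t) := fun t ht =>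
    EReal.coe_toReal (hu.ne_top_of_ne_zero hn hp hr (by
      rintro h
      have := hX2 t ht
      rw [h] at this
      simp at this
      linarith)) (hu.ne_bot _ (mem_univ _))
  have hgx : ∀ x, x ≠ 0 → (g (‖x‖ ^ 2) : EReal) = u x := fun x hx => by
    have : 0 < ‖x‖ := norm_pos_iff.2 hx
    rw [hg _ (by positivity)]
    exact hr.congr (by rw [hX, Real.sqrt_sq this.le])
  have hanti : ∀ s t, 0 < s → s ≤ t → g t ≤ g s := fun s t hs hst => by
    have := hu.antitone_norm hn hp hr (x := X s) (y := X t)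
      (by rw [hX, hX]; exact Real.sqrt_le_sqrt hst)
    rw [← hg s hs, ← hg t (hs.trans_le hst)] at this
    exact_mod_cast this
  set t₀ := ‖x₀‖ ^ 2 with ht₀def
  have ht₀ : 0 < t₀ := by have := norm_pos_iff.2 hx₀; positivity
  have hκ := expThreshold_pos hn hp
  set κ := expThreshold n p with hκdef
  have hw := weight_add_pos hp
  set w := traceWeight p + dirWeight p with hwdef
  have hd : 0 ≤ g t₀ - g (2 * t₀) := by linarith [hanti t₀ (2 * t₀) ht₀ (by linarith)]
  have hκe : 0 < 1 - Real.exp (-κ) := by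
    have : Real.exp (-κ) < 1 := by rw [Real.exp_lt_one_iff]; linarith
    linarith
  -- A bound for `4 w l b exp (-l t₀)` independent of `δ ≤ 1`. Since `l t₀ - κ = δ`, `dirLaplace` is
  -- then at most `M δ |v|^2`.
  set M := 4 * w * ((κ + 1) / t₀ * ((g t₀ - g (2 * t₀)) / (1 - Real.exp (-κ)))) with hM
  have hM0 : 0 ≤ M := by positivity
  set δ := min 1 (ε / (M + 1)) with hδ
  have hδ0 : 0 < δ := lt_min one_pos (by positivity)
  have hδ1 : δ ≤ 1 := min_le_left _ _
  have hδM : M * δ ≤ ε := by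
    have h1 : δ ≤ ε / (M + 1) := min_le_right _ _
    rw [le_div_iff₀ (by linarith)] at h1
    nlinarith
  set l := (κ + δ) / t₀ with hl
  have hl0 : 0 < l := by positivity
  have hlt : l * t₀ = κ + δ := by rw [hl]; field_simp
  have hτ : κ / l < t₀ := by rw [div_lt_iff₀ hl0]; linarith
  have hτ0 : 0 < κ / l := by positivity
  have he : StrictAnti fun t => Real.exp (-(l * t)) := fun s t hst =>
    Real.exp_lt_exp.2 (neg_lt_neg (mul_lt_mul_of_pos_left hst hl0))
  obtain ⟨b, hb, hsup⟩ := exists_supporting_slope (g := g) hτ he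
    (fun s t hs hst => hanti s t (hτ0.trans hs) hst) (by
      intro t₁ t t₃ a b h1 h1t ht3 hb hu1 hu3
      have p1 := hτ0.trans h1
      have pt := p1.trans_le h1t
      have p3 := pt.trans_le ht3
      have := hu.exp_barrier_le hn hp hr (x₁ := X t₁) (x := X t) (x₃ := X t₃) (a := a)
        (by rw [hX, hX]; exact Real.sqrt_le_sqrt h1t)
        (by rw [hX, hX]; exact Real.sqrt_le_sqrt ht3) hb hl0
        (by rw [hX2 _ p1]; rw [div_lt_iff₀ hl0] at h1; linarith)
        (by rw [hX2 _ p1, ← hg _ p1]; exact_mod_cast hu1)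
        (by rw [hX2 _ p3, ← hg _ p3]; exact_mod_cast hu3)
      rw [hX2 _ pt, ← hg _ pt] at this
      exact_mod_cast this)
  -- The supporting line evaluated at `2 t₀` bounds its own slope, because `l t₀ ≥ κ`.
  have hslope : b * Real.exp (-(l * t₀)) ≤ (g t₀ - g (2 * t₀)) / (1 - Real.exp (-κ)) := by
    rw [le_div_iff₀ hκe]
    have h1 := hsup (2 * t₀) (by linarith)
    have h2 : Real.exp (-(l * (2 * t₀))) ≤ Real.exp (-(l * t₀)) * Real.exp (-κ) := by
      rw [← Real.exp_add]
      exact Real.exp_le_exp.2 (by linarith)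
    nlinarith [mul_le_mul_of_nonneg_left h2 hb]
  refine ⟨fun x => (g t₀ - b * Real.exp (-(l * t₀))) + b * Real.exp (-(l * ‖x - 0‖ ^ 2)),
    contDiff_exp_barrier _ b l, ?_, ?_, fun v => ?_⟩
  · rw [← hgx x₀ hx₀]
    simp only [sub_zero, ← ht₀def]
    norm_cast
    ring
  · have hopen : IsOpen {x : EuclideanSpace ℝ (Fin n) | κ / l < ‖x‖ ^ 2} :=
      isOpen_lt continuous_const (continuous_norm.pow 2)
    filter_upwards [hopen.mem_nhds hτ] with x hx
    have hx : κ / l < ‖x‖ ^ 2 := hx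
    have hx0 : x ≠ 0 := by
      rintro rfl
      simp at hx
      linarith
    rw [← hgx x hx0, sub_zero]
    norm_cast
    linarith [hsup _ hx]
  · refine (dirLaplace_exp_barrier_le hp hb x₀ v).trans
      (mul_le_mul_of_nonneg_right ?_ (by positivity))
    rw [← ht₀def, ← hκdef, ← hwdef, hlt, add_sub_cancel_left]
    refine le_trans (mul_le_mul_of_nonneg_right ?_ hδ0.le) hδM
    rw [hM]
    refine mul_le_mul_of_nonneg_left ?_ (by positivity)
    rw [mul_assoc]
    refine mul_le_mul ?_ (hlt ▸ hslope) (by positivity) (by positivity)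
    rw [hl]
    gcongr

/-! ### Finite sums and the superposition principle -/

lemma EReal.sum_ne_bot {ι : Type*} (s : Finset ι) {f : ι → EReal} (h : ∀ i ∈ s, f i ≠ ⊥) :
    ∑ i ∈ s, f i ≠ ⊥ := by
  classical
  induction s using Finset.induction_on with
  | empty => simp
  | insert i s hi ih =>
    rw [Finset.sum_insert hi]
    exact EReal.add_ne_bot_iff.2 ⟨h i (by simp), ih fun j hj => h j (by simp [hj])⟩

lemma EReal.sum_ne_top_iff {ι : Type*} (s : Finset ι) {f : ι → EReal} (h : ∀ i ∈ s, f i ≠ ⊥) :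
    ∑ i ∈ s, f i ≠ ⊤ ↔ ∀ i ∈ s, f i ≠ ⊤ := by
  classical
  induction s using Finset.induction_on with
  | empty => simp
  | insert i s hi ih =>
    have hs : ∀ j ∈ s, f j ≠ ⊥ := fun j hj => h j (by simp [hj])
    rw [Finset.sum_insert hi, EReal.add_ne_top_iff_ne_top₂ (h i (by simp)) (EReal.sum_ne_bot s hs),
      ih hs]
    simp

lemma lowerSemicontinuous_ereal_sum {α ι : Type*} [TopologicalSpace α] (s : Finset ι)
    {f : ι → α → EReal} (hbot : ∀ i ∈ s, ∀ x, f i x ≠ ⊥)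
    (h : ∀ i ∈ s, LowerSemicontinuous (f i)) : LowerSemicontinuous fun x => ∑ i ∈ s, f i x := by
  classical
  induction s using Finset.induction_on with
  | empty => simpa using lowerSemicontinuous_const
  | insert i s hi ih =>
    have hs : ∀ j ∈ s, ∀ x, f j x ≠ ⊥ := fun j hj => hbot j (by simp [hj])
    simp only [Finset.sum_insert hi]
    refine (h i (by simp)).add' (ih hs fun j hj => h j (by simp [hj])) fun x =>
      EReal.continuousAt_add (Or.inr ?_) (Or.inl ?_)
    · exact EReal.sum_ne_bot s fun j hj => hs j hj x
    · exact hbot i (by simp) x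

/-- If the Hessian of `φ` is at most that of `ψ`, then so are the values of `dirLaplace`. -/
lemma dirLaplace_le_sum {n N : ℕ} {p : ℝ≥0∞} (hp : 2 ≤ p)
    {φ : EuclideanSpace ℝ (Fin n) → ℝ} {ψ : Fin N → EuclideanSpace ℝ (Fin n) → ℝ}
    {x : EuclideanSpace ℝ (Fin n)} {z : Fin N → EuclideanSpace ℝ (Fin n)}
    (h : ∀ v, secondDeriv φ x v ≤ ∑ i, secondDeriv (ψ i) (z i) v)
    (v : EuclideanSpace ℝ (Fin n)) :
    dirLaplace p v φ x ≤ ∑ i, dirLaplace p v (ψ i) (z i) := by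
  unfold dirLaplace
  rw [Finset.sum_add_distrib, ← Finset.mul_sum, ← Finset.mul_sum, Finset.sum_comm]
  have := dirWeight_nonneg hp
  have := traceWeight_nonneg p
  gcongr
  · exact h _
  · exact h v

theorem theorem2 (n : ℕ) (hn : 2 ≤ n) (p : ℝ≥0∞) (hp : 2 ≤ p) (N : ℕ)
    (u : Fin N → EuclideanSpace ℝ (Fin n) → EReal)
    (hrad : ∀ i, IsRadial (u i))
    (hu : ∀ i, IsPSuperharmonicOn p univ (u i))
    (y : Fin N → EuclideanSpace ℝ (Fin n))
    (K : EuclideanSpace ℝ (Fin n) → ℝ) (hK : ConcaveOn ℝ univ K) :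
    IsPSuperharmonicOn p univ
      (fun x => (∑ i, u i (x - y i)) + ((K x : ℝ) : EReal)) := by
  have hn0 : 0 < n := by omega
  have hbot : ∀ i x, u i (x - y i) ≠ ⊥ := fun i x => (hu i).ne_bot _ (mem_univ _)
  have hsbot : ∀ x, ∑ i, u i (x - y i) ≠ ⊥ := fun x => EReal.sum_ne_bot _ fun i _ => hbot i x
  refine ⟨fun x _ => EReal.add_ne_bot_iff.2 ⟨hsbot x, EReal.coe_ne_bot _⟩, ?_, ?_, ?_⟩
  · refine LowerSemicontinuous.lowerSemicontinuousOn ?_ _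
    refine (lowerSemicontinuous_ereal_sum _ (fun i _ x => hbot i x) fun i _ => ?_).add' ?_
      fun x => EReal.continuousAt_add (Or.inr (EReal.coe_ne_bot _)) (Or.inr (EReal.coe_ne_top _))
    · exact (lowerSemicontinuousOn_univ_iff.1 (hu i).lowerSemicontinuousOn).comp
        (continuous_id.sub continuous_const)
    · have : Continuous K := continuousOn_univ.1 (hK.continuousOn isOpen_univ)
      exact (continuous_coe_real_ereal.comp this).lowerSemicontinuous
  · have : Nontrivial (EuclideanSpace ℝ (Fin n)) := by
      have : Nonempty (Fin n) := ⟨⟨0, hn0⟩⟩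
      infer_instance
    -- The sum can be infinite only at the finitely many centres `y i`.
    have hdense : Dense (range y)ᶜ := (finite_range y).countable.dense_compl ℝ
    intro x _
    refine closure_mono ?_ (hdense x)
    intro a ha
    refine ⟨mem_univ a, lt_top_iff_ne_top.2 ?_⟩
    rw [EReal.add_ne_top_iff_ne_top₂ (hsbot a) (EReal.coe_ne_bot _),
      EReal.sum_ne_top_iff _ fun i _ => hbot i a]
    refine ⟨fun i _ => (hu i).ne_top_of_ne_zero hn0 hp (hrad i) ?_, EReal.coe_ne_top _⟩
    rw [sub_ne_zero]
    rintro rfl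
    exact ha (mem_range_self i)
  · intro x₀ _ φ hφ
    have hfin : ∀ i, u i (x₀ - y i) ≠ ⊤ := by
      have h1 : (∑ i, u i (x₀ - y i)) + ((K x₀ : ℝ) : EReal) ≠ ⊤ := by
        rw [← hφ.eq_at]
        exact EReal.coe_ne_top _
      rw [EReal.add_ne_top_iff_ne_top₂ (hsbot x₀) (EReal.coe_ne_bot _),
        EReal.sum_ne_top_iff _ fun i _ => hbot i x₀] at h1
      exact fun i => h1.1 i (Finset.mem_univ i)
    have coe_sum : ∀ f : Fin N → ℝ, ((∑ i, f i : ℝ) : EReal) = ∑ i, (f i : EReal) := fun f =>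
      map_sum (⟨⟨Real.toEReal, EReal.coe_zero⟩, EReal.coe_add⟩ : ℝ →+ EReal) f Finset.univ
    refine pLaplaceFun_nonpos hn0 _ fun v => ?_
    have key : ∀ ε : ℝ, 0 < ε → dirLaplace p v φ x₀ ≤ N * (ε * ‖v‖ ^ 2) := by
      intro ε hε
      choose ψ hψ heq hle hlap using fun i =>
        (hu i).exists_touching_above hn0 hp (hrad i) (hfin i) hε
      have hψs : ∀ i, ContDiff ℝ 2 fun x => ψ i (x - y i) := fun i =>
        (hψ i).comp (contDiff_id.sub contDiff_const)
      have hΨ : ContDiff ℝ 2 fun x => ∑ i, ψ i (x - y i) := ContDiff.sum fun i _ => hψs i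
      have hf : ContDiffAt ℝ 2 (fun x => (∑ i, ψ i (x - y i)) - φ x) x₀ :=
        hΨ.contDiffAt.sub hφ.contDiffAt
      have hat : (∑ i, ψ i (x₀ - y i)) - φ x₀ = -K x₀ := by
        have h1 := hφ.eq_at
        simp only [← heq, ← coe_sum] at h1
        norm_cast at h1
        linarith
      have hnear : ∀ᶠ x in 𝓝 x₀, -K x ≤ (∑ i, ψ i (x - y i)) - φ x := by
        have h2 : ∀ᶠ x in 𝓝 x₀, ∀ i, u i (x - y i) ≤ ψ i (x - y i) :=
          eventually_all.2 fun i =>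
            ((continuous_id.sub continuous_const).tendsto' x₀ (x₀ - y i) rfl).eventually (hle i)
        filter_upwards [h2, hφ.le_near] with x h2 h3
        have h4 := h3.trans (add_le_add_left (Finset.sum_le_sum fun i _ => h2 i) _)
        rw [← coe_sum] at h4
        norm_cast at h4
        linarith
      have hsecond : ∀ w, secondDeriv φ x₀ w ≤ ∑ i, secondDeriv (ψ i) (x₀ - y i) w := by
        intro w
        -- Midpoint convexity of `-K` gives nonnegative second differences at `x₀`, so `K` need not
        -- be differentiable.
        have h5 : 0 ≤ secondDeriv (fun x => (∑ i, ψ i (x - y i)) - φ x) x₀ w := by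
          refine secondDeriv_nonneg_of_second_difference hf ?_
          have ht : ∀ w' : EuclideanSpace ℝ (Fin n),
              Tendsto (fun s : ℝ => x₀ + s • w') (𝓝 0) (𝓝 x₀) := fun w' =>
            Continuous.tendsto' (by fun_prop) _ _ (by simp)
          filter_upwards [(ht w).eventually hnear, (ht (-w)).eventually hnear] with s h6 h7
          rw [smul_neg, ← sub_eq_add_neg] at h7
          have h8 := hK.2 (mem_univ (x₀ + s • w)) (mem_univ (x₀ - s • w))
            (by norm_num : (0 : ℝ) ≤ 1 / 2) (by norm_num : (0 : ℝ) ≤ 1 / 2) (by norm_num)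
          have h9 : (1 / 2 : ℝ) • (x₀ + s • w) + (1 / 2 : ℝ) • (x₀ - s • w) = x₀ := by module
          rw [h9, smul_eq_mul, smul_eq_mul] at h8
          rw [hat]
          linarith
        rw [secondDeriv_sub hΨ.contDiffAt hφ.contDiffAt, secondDeriv_sum _ hψs] at h5
        simp only [secondDeriv_comp_sub_const] at h5
        linarith
      refine (dirLaplace_le_sum hp hsecond v).trans ?_
      refine (Finset.sum_le_sum fun i _ => hlap i v).trans (le_of_eq ?_)
      simp
    by_contra! hpos
    set D := dirLaplace p v φ x₀
    have hC : 0 ≤ (N : ℝ) * ‖v‖ ^ 2 := by positivity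
    -- The `+ 1` covers `N = 0` and `v = 0`.
    have h1 := key (D / (N * ‖v‖ ^ 2 + 1)) (by positivity)
    have h2 : D / (N * ‖v‖ ^ 2 + 1) * (N * ‖v‖ ^ 2 + 1) = D := by field_simp
    have h3 : 0 < D / (N * ‖v‖ ^ 2 + 1) := by positivity
    nlinarith
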